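/- Let $(R,\mathfrak m)$ be a $3$-dimensional (Noetherian) Cohen–Macaulay local ring of characteristic $2$, and let $x,y,z$ be a system of parameters for $R$. Let $\alpha,\beta,\gamma,\alpha',\beta',\gamma'$ be positive integers with $$\alpha=1,\quad \alpha'=2,\quad 2\beta\le\beta',\quad 2\gamma\le\gamma',$$ and let $I$ be the ideal of $R$ generated by the maximal minors of the matrix $$\begin{pmatrix} x^{\alpha} & y^{\beta} & z^{\gamma}\\ y^{\beta'} & z^{\gamma'} & x^{\alpha'}\end{pmatrix}.$$ Put $Q=(x^{\min\{\alpha,\alpha'\}},\,y^{\min\{\beta,\beta'\}},\,z^{\min\{\gamma,\gamma'\}})R$ (so $Q=(x,y^{\beta},z^{\gamma})R$), and let $$I^{(3)}=\bigcap_{\mathfrak p\in\operatorname{Min}_R(R/I)}\bigl(I^3R_{\mathfrak p}\cap R\bigr)$$ be the third symbolic power of $I$. Then $$\operatorname{depth} R/(I^3:_R Q^3)>0\qquad\text{and}\qquad I^{(3)}=I^3:_R Q^3 .$$ Moreover, writing $\ell_R$ for length of $R$-modules, $$\ell_R\bigl(I^{(3)}/I^3\bigr)=7\cdot\ell_R(R/Q)=7\beta\gamma\cdot\ell_R\bigl(R/(x,y,z)R\bigr).$$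 -/

import Mathlib

/-- The depth of a module `M` over a local ring `R`: the supremum of the lengths of the
`M`-regular sequences contained in the maximal ideal. -/
noncomputable def moduleDepth (R : Type*) [CommRing R] [IsLocalRing R]
    (M : Type*) [AddCommGroup M] [Module R M] : ℕ∞ :=
  ⨆ (rs : List R) (_ : (∀ r ∈ rs, r ∈ IsLocalRing.maximalIdeal R) ∧
    RingTheory.Sequence.IsRegular M rs), (rs.length : ℕ∞)

/-- A Cohen-Macaulay local ring: a Noetherian local ring whose depth equals its Krull dimension. -/
class IsCohenMacaulayLocalRing (R : Type*) [CommRing R] : Prop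
    extends IsLocalRing R, IsNoetherianRing R where
  depth_eq_dim : (moduleDepth R R : WithBot ℕ∞) = ringKrullDim R

/-- `d` elements of a local ring of Krull dimension `d` that generate an ideal which is primary
to the maximal ideal. -/
def IsSystemOfParameters {R : Type*} [CommRing R] [IsLocalRing R] {d : ℕ} (s : Fin d → R) : Prop :=
  ringKrullDim R = d ∧ (Ideal.span (Set.range s)).radical = IsLocalRing.maximalIdeal R

/-- The ideal generated by the maximal minors of an `m × n` matrix, where `m ≤ n`. -/
def maximalMinorsIdeal {R : Type*} [CommRing R] {m n : ℕ} (A : Matrix (Fin m) (Fin n) R) :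
    Ideal R :=
  Ideal.span (Set.range fun f : Fin m ↪o Fin n => (A.submatrix id f).det)

/-- The `n`-th symbolic power of `I`: the intersection, over the minimal primes `p` of `I`,
of the preimages in `R` of the ideals `I ^ n R_p`. -/
def symbolicPower {R : Type*} [CommRing R] (I : Ideal R) (n : ℕ) : Ideal R :=
  ⨅ (p : PrimeSpectrum R) (_ : p.asIdeal ∈ I.minimalPrimes),
    ((I ^ n).map (algebraMap R (Localization.AtPrime p.asIdeal))).comap
      (algebraMap R (Localization.AtPrime p.asIdeal))

/-- The length of the `R`-module `J / K`, for ideals `K ⊆ J`. -/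
noncomputable def quotientLength {R : Type*} [CommRing R] (J K : Ideal R) : ℕ∞ :=
  Module.length R (J ⧸ Submodule.submoduleOf K J)

theorem pow_le_symbolicPower {R : Type*} [CommRing R] (I : Ideal R) (n : ℕ) :
    I ^ n ≤ symbolicPower I n :=
  le_iInf fun _ => le_iInf fun _ => Ideal.le_comap_map

/-!
In characteristic two write the matrix with rows `(a, b, c)` and `(u * b ^ 2, v * c ^ 2, a ^ 2)`,
and let `f, g, h` be its minors. The element `u * f ^ 3 + g ^ 2 * h` of `I ^ 3` is divisible by
`c ^ 2`, and its quotient `d` satisfies similar identities for `a ^ 2`, `b ^ 2` and `a * b * c`.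
The relations between the ten cubics in `f, g, h` and `d` obtained in this way form a matrix that
is upper triangular modulo `a`, with entries that are monomials in `b, c, u, v`. Because `a` is
followed by regular sequences of such monomials, these relations generate all relations modulo
`a`. It follows that `a` is regular modulo `I ^ 3 + (d)` and that `I ^ 3 : d` is generated by
`a ^ 2, b ^ 2, c ^ 2, a * b * c`. Since a power of `a` multiplies `I ^ 3 + (d)` into `I ^ 3`, this
ideal is the third symbolic power and also `I ^ 3 : Q ^ 3`, while
`I ^ (3) / I ^ 3 ≅ R / (a ^ 2, b ^ 2, c ^ 2, a * b * c)` has length `7 * ℓ (R / Q)`.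
-/

section Depth

open IsLocalRing RingTheory.Sequence Module

universe u

variable {R : Type u} [CommRing R]

theorem annihilator_sup_ofList_cons_le {M N : Type*} [AddCommGroup M] [Module R M] [AddCommGroup N]
    [Module R N] (hMN : annihilator R M ≤ annihilator R N) {r : R} (hr : r ∈ annihilator R N)
    (rs : List R) :
    annihilator R M ⊔ Ideal.ofList (r :: rs) ≤ annihilator R N ⊔ Ideal.ofList rs := by
  rw [Ideal.ofList_cons, ← sup_assoc]
  exact sup_le_sup_right (sup_le hMN ((Ideal.span_singleton_le_iff_mem _).2 hr)) _

theorem annihilator_sup_ofList_cons_le_quotSMulTop {M : Type*} [AddCommGroup M] [Module R M]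
    (r : R) (rs : List R) : annihilator R M ⊔ Ideal.ofList (r :: rs) ≤
      annihilator R (QuotSMulTop r M) ⊔ Ideal.ofList rs :=
  annihilator_sup_ofList_cons_le
    (LinearMap.annihilator_le_of_surjective _ (Submodule.mkQ_surjective _))
    (QuotSMulTop.mem_annihilator M r) rs

variable [IsLocalRing R]

theorem le_moduleDepth_iff {M : Type*} [AddCommGroup M] [Module R M] [Nontrivial M]
    [Module.Finite R M] {n : ℕ} :
    n ≤ moduleDepth R M ↔
      ∃ rs : List R, rs.length = n ∧ (∀ r ∈ rs, r ∈ maximalIdeal R) ∧ IsRegular M rs := by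
  refine ⟨fun h => ?_, ?_⟩
  · rcases n with _ | n
    · exact ⟨[], by simp, by simp, .nil R M⟩
    have h' : (n : ℕ∞) < moduleDepth R M := (Nat.cast_lt.2 n.lt_succ_self).trans_le h
    simp only [moduleDepth, lt_iSup_iff] at h'
    obtain ⟨rs, ⟨hm, hrs⟩, hn⟩ := h'
    have hm' : ∀ r ∈ rs.take (n + 1), r ∈ maximalIdeal R := fun r hr =>
      hm r (List.mem_of_mem_take hr)
    refine ⟨rs.take (n + 1), List.length_take_of_le (by exact_mod_cast hn), hm',
      .of_isWeaklyRegular_of_mem_maximalIdeal M hm' ?_⟩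
    rw [← List.take_append_drop (n + 1) rs] at hrs
    exact ((isWeaklyRegular_append_iff ..).1 hrs.1).1
  · rintro ⟨rs, rfl, hm, hrs⟩
    exact le_iSup₂_of_le rs ⟨hm, hrs⟩ le_rfl

theorem moduleDepth_quotient_pos {J : Ideal R} (hJ : J ≠ ⊤) {x : R} (hx : x ∈ maximalIdeal R)
    (h : IsSMulRegular (R ⧸ J) x) :
    0 < moduleDepth R (R ⧸ J) := by
  have : Nontrivial (R ⧸ J) := Ideal.Quotient.nontrivial_iff.2 hJ
  have one_le : ((1 : ℕ) : ℕ∞) ≤ moduleDepth R (R ⧸ J) :=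
    le_moduleDepth_iff.2 ⟨[x], rfl, by simpa using hx, .of_isWeaklyRegular_of_mem_maximalIdeal _
      (by simpa using hx) ((isWeaklyRegular_singleton_iff _ x).2 h)⟩
  exact zero_lt_one.trans_le one_le

variable [IsNoetherianRing R]

theorem le_moduleDepth_quotSMulTop {M : Type u} [AddCommGroup M]
    [Module R M] [Nontrivial M] [Module.Finite R M] {n : ℕ}
    (h : (n + 1 : ℕ) ≤ moduleDepth R M) {x : R} (hx : x ∈ maximalIdeal R)
    (hxM : IsSMulRegular M x) :
    n ≤ moduleDepth R (QuotSMulTop x M) := by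
  have smul_lt (N : Type u) [AddCommGroup N] [Module R N] [Nontrivial N] [Module.Finite R N] :
      maximalIdeal R • (⊤ : Submodule R N) < ⊤ :=
    (Submodule.top_ne_ideal_smul_of_le_jacobson_annihilator
      (maximalIdeal_le_jacobson _)).symm.lt_top
  have : Nontrivial (QuotSMulTop x M) := nontrivial_quotSMulTop_of_mem_maximalIdeal M hx
  have ext_eq_zero :=
    ((ModuleCat.exists_isRegular_tfae (maximalIdeal R) (n + 1) (ModuleCat.of R M)
      (smul_lt M)).out 3 1).1 (le_moduleDepth_iff.1 h)
  refine le_moduleDepth_iff.2 (((ModuleCat.exists_isRegular_tfae (maximalIdeal R) n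
    (ModuleCat.of R (QuotSMulTop x M)) (smul_lt _)).out 1 3).1 fun i hi => ?_)
  have zero₂ := AddCommGrpCat.isZero_of_iff_subsingleton.mpr (ext_eq_zero i (by omega))
  have zero₁ := AddCommGrpCat.isZero_of_iff_subsingleton.mpr (ext_eq_zero (i + 1) (by omega))
  exact AddCommGrpCat.subsingleton_of_isZero <|
    (CategoryTheory.Abelian.Ext.covariant_sequence_exact₃' _
      (IsSMulRegular.smulShortComplex_shortExact (M := ModuleCat.of R M) hxM)
      i (i + 1) rfl).isZero_of_both_zeros (zero₂.eq_zero_of_src _) (zero₁.eq_zero_of_tgt _)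

open scoped Pointwise in
theorem length_le_supportDim_of_ne_bot {M : Type*} [AddCommGroup M] [Module R M]
    [Module.Finite R M] {rs : List R} (hm : ∀ r ∈ rs, r ∈ maximalIdeal R)
    (hrs : IsWeaklyRegular M rs) {N : Submodule R M} (hN : N ≠ ⊥) :
    rs.length ≤ supportDim R N := by
  induction rs generalizing M with
  | nil =>
    have : Nontrivial N := Submodule.nontrivial_iff_ne_bot.2 hN
    exact Order.krullDim_nonneg_iff.2 (nonempty_support_iff.2 this).to_subtype
  | cons r rs ih =>
    obtain ⟨hr, hrs⟩ := (isWeaklyRegular_cons_iff M r rs).1 hrs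
    obtain ⟨hrm, hm⟩ := List.forall_mem_cons.1 hm
    -- `T` contains `N` and has the same annihilator, and `M ⧸ T` has no `r`-torsion.
    let T : Submodule R M := Submodule.torsionBySet R M (annihilator R N)
    have mem_T {t : M} : t ∈ T ↔ ∀ b ∈ annihilator R N, b • t = 0 := by
      simp [T, Submodule.mem_torsionBySet_iff]
    have T_ne_bot : T ≠ ⊥ := ne_bot_of_le_ne_bot hN fun t ht => mem_T.2 fun b hb =>
      congrArg Subtype.val (mem_annihilator.1 hb ⟨t, ht⟩)
    have supportDim_T : supportDim R T ≤ supportDim R N := by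
      have : annihilator R N ≤ annihilator R T := fun b hb =>
        mem_annihilator.2 fun t => Subtype.ext (mem_T.1 t.2 b hb)
      simp only [supportDim_eq_ringKrullDim_quotient_annihilator]
      exact ringKrullDim_le_of_surjective (Ideal.Quotient.factor this)
        (Ideal.Quotient.factor_surjective this)
    let N' := LinearMap.range (QuotSMulTop.map r T.subtype)
    have N'_ne_bot : N' ≠ ⊥ := by
      refine fun h => T_ne_bot <| Submodule.eq_bot_of_eq_pointwise_smul_of_mem_jacobson_annihilator
        (IsNoetherian.noetherian T) (le_antisymm (fun t ht => ?_) (T.smul_le_self_of_tower r))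
        (maximalIdeal_le_jacobson _ hrm)
      have mem_N' : (Submodule.Quotient.mk t : QuotSMulTop r M) ∈ N' :=
        ⟨Submodule.Quotient.mk ⟨t, ht⟩, rfl⟩
      rw [h, Submodule.mem_bot] at mem_N'
      obtain ⟨s, -, rfl⟩ := (Submodule.Quotient.mk_eq_zero _).1 mem_N'
      refine Submodule.smul_mem_pointwise_smul s r T (mem_T.2 fun b hb => hr ?_)
      simpa [smul_comm r b] using mem_T.1 ht b hb
    calc ((r :: rs).length : WithBot ℕ∞) = rs.length + 1 := by simp
      _ ≤ supportDim R N' + 1 := by gcongr; exact ih hm hrs N'_ne_bot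
      _ ≤ supportDim R (QuotSMulTop r T) + 1 := by
        gcongr
        exact supportDim_le_of_surjective _ (LinearMap.surjective_rangeRestrict _)
      _ = supportDim R T := supportDim_quotSMulTop_succ_eq_supportDim (hr.submodule T r) hrm
      _ ≤ supportDim R N := supportDim_T

theorem supportDim_le_length {M : Type*} [AddCommGroup M] [Module R M] [Module.Finite R M]
    {rs : List R} (hm : ∀ r ∈ rs, r ∈ maximalIdeal R)
    (h : maximalIdeal R ≤ (annihilator R M ⊔ Ideal.ofList rs).radical) :
    supportDim R M ≤ rs.length := by
  induction rs generalizing M with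
  | nil =>
    rw [Ideal.ofList_nil, sup_bot_eq] at h
    have : Ring.KrullDimLE 0 (R ⧸ annihilator R M) :=
      Ideal.krullDimLE_zero_quotient_iff_forall_minimalPrimes_isMaximal.2 fun p hp => by
        have := hp.1.1
        have hle : maximalIdeal R ≤ p := h.trans (this.radical_le_iff.2 hp.1.2)
        rw [← (maximalIdeal.isMaximal R).eq_of_le this.ne_top hle]
        infer_instance
    rw [supportDim_eq_ringKrullDim_quotient_annihilator]
    exact Order.KrullDimLE.krullDim_le
  | cons r rs ih =>
    obtain ⟨hrm, hm⟩ := List.forall_mem_cons.1 hm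
    calc supportDim R M ≤ supportDim R (QuotSMulTop r M) + 1 :=
          supportDim_le_supportDim_quotSMulTop_succ hrm
      _ ≤ rs.length + 1 := by
          gcongr
          exact ih hm (h.trans
            (Ideal.radical_mono (annihilator_sup_ofList_cons_le_quotSMulTop r rs)))
      _ = (r :: rs).length := by simp

theorem isWeaklyRegular_of_length_le_moduleDepth {M : Type u} [AddCommGroup M]
    [Module R M] [Nontrivial M]
    [Module.Finite R M] {rs : List R} (hm : ∀ r ∈ rs, r ∈ maximalIdeal R)
    (h : maximalIdeal R ≤ (annihilator R M ⊔ Ideal.ofList rs).radical)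
    (hdepth : rs.length ≤ moduleDepth R M) : IsWeaklyRegular M rs := by
  induction rs generalizing M with
  | nil => exact .nil R M
  | cons r rs ih =>
    obtain ⟨hrm, hm⟩ := List.forall_mem_cons.1 hm
    have := nontrivial_quotSMulTop_of_mem_maximalIdeal M hrm
    have hr : IsSMulRegular M r := by
      by_contra hr
      let N : Submodule R M := LinearMap.ker (LinearMap.lsmul R M r)
      have hN : N ≠ ⊥ := fun h => hr (isSMulRegular_of_ker_lsmul_eq_bot h)
      obtain ⟨ss, hss, hssm, hreg⟩ := le_moduleDepth_iff.1 hdepth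
      have hlower := length_le_supportDim_of_ne_bot hssm hreg.1 hN
      have hann : annihilator R M ⊔ Ideal.ofList (r :: rs) ≤ annihilator R N ⊔ Ideal.ofList rs :=
        annihilator_sup_ofList_cons_le (LinearMap.annihilator_le_of_injective _ N.injective_subtype)
          (mem_annihilator.2 fun t => Subtype.ext t.2) rs
      have hupper := supportDim_le_length hm (h.trans (Ideal.radical_mono hann))
      have : ss.length ≤ rs.length := by exact_mod_cast hlower.trans hupper
      simp [hss] at this
    exact .cons hr <| ih hm
      (h.trans (Ideal.radical_mono (annihilator_sup_ofList_cons_le_quotSMulTop r rs)))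
      (le_moduleDepth_quotSMulTop hdepth hrm hr)

end Depth

section Syzygies

variable {R : Type*} [CommRing R] {A : Ideal R}

theorem mem_sup_span_singleton_iff {r t : R} : t ∈ A ⊔ Ideal.span {r} ↔ ∃ s, t - r * s ∈ A := by
  rw [sup_comm, Ideal.mem_span_singleton_sup]
  exact ⟨fun ⟨s, b, hb, h⟩ => ⟨s, by rwa [← h, mul_comm, add_sub_cancel_left]⟩,
    fun ⟨s, h⟩ => ⟨s, _, h, by ring⟩⟩

theorem mem_of_mul_mem {r t : R} (hr : IsSMulRegular (R ⧸ A) r) (h : r * t ∈ A) : t ∈ A :=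
  mem_of_isSMulRegular_quotient_of_smul_mem hr h

open Matrix

theorem mul_mem_of_dotProduct_mem {ι : Type*} [Fintype ι] {B : Ideal R} {t w : ι → R}
    (h : t ⬝ᵥ w ∈ B) (i : ι) (hj : ∀ j ≠ i, t j * w j ∈ B) : t i * w i ∈ B := by
  classical
  rw [dotProduct, ← Finset.add_sum_erase _ _ (Finset.mem_univ i)] at h
  exact (add_mem_cancel_right (sum_mem fun j hj' => hj j (Finset.ne_of_mem_erase hj'))).1 h

theorem exists_dotProduct_eq_zero_of_mul_mem_span {ι : Type*} [Fintype ι] {w : ι → R} {j : ι}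
    {s : R} (hs : s * w j ∈ Ideal.span (w '' {j}ᶜ)) : ∃ t : ι → R, t ⬝ᵥ w = 0 ∧ t j = s := by
  classical
  rw [← Finset.coe_singleton, ← Finset.coe_compl,
    Submodule.mem_span_image_finset_iff_exists_fun'] at hs
  obtain ⟨c, hc⟩ := hs
  refine ⟨Function.update (-c) j s, ?_, Function.update_self ..⟩
  rw [dotProduct, Fintype.sum_eq_add_sum_compl j, Function.update_self, ← hc,
    ← Finset.sum_add_distrib]
  refine Finset.sum_eq_zero fun i hi => ?_
  rw [Function.update_of_ne (by simpa using hi)]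
  simp

/-- The rows of `M` are relations between the entries of `w` and are upper triangular modulo `A`,
while `w i` is congruent to `P i * q i` modulo `A` and `P (i + 1)`, where `P i` is the product of
the first `i` diagonal entries of `M`. The regularity conditions make the rows of `M` generate all
the relations between the entries of `w` modulo `A`. -/
structure IsTriangularPresentation {n : ℕ} (A : Ideal R) (w : Fin (n + 1) → R)
    (M : Matrix (Fin n) (Fin (n + 1)) R) (P : Fin (n + 1) → R) (q : Fin n → R) : Prop where
  mulVec_eq_zero : M *ᵥ w = 0
  mem_of_lt : ∀ i j, j < i.castSucc → M i j ∈ A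
  succ_eq_mul : ∀ i : Fin n, P i.succ = P i.castSucc * M i i.castSucc
  sub_mul_mem : ∀ i : Fin n, w i.castSucc - P i.castSucc * q i ∈ A ⊔ Ideal.span {P i.succ}
  last_sub_mem : w (Fin.last n) - P (Fin.last n) ∈ A
  isSMulRegular_last : IsSMulRegular (R ⧸ A) (P (Fin.last n))
  isSMulRegular_cofactor : ∀ i : Fin n,
    IsSMulRegular (R ⧸ A ⊔ Ideal.span {M i i.castSucc}) (q i)

namespace IsTriangularPresentation

variable {n : ℕ} {w : Fin (n + 1) → R} {M : Matrix (Fin n) (Fin (n + 1)) R} {P : Fin (n + 1) → R}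
  {q : Fin n → R}

theorem dvd_of_le (h : IsTriangularPresentation A w M P q) {i j : Fin (n + 1)} (hij : i ≤ j) :
    P i ∣ P j := by
  induction j using Fin.induction with
  | zero => rw [Fin.le_zero_iff.1 hij]
  | succ j ih =>
    rcases hij.lt_or_eq with hij | rfl
    · exact (ih (Fin.le_castSucc_iff.2 hij)).trans (h.succ_eq_mul j ▸ dvd_mul_right _ _)
    · rfl

theorem mem_sup_span_of_le (h : IsTriangularPresentation A w M P q) {i j : Fin (n + 1)}
    (hij : i ≤ j) : w j ∈ A ⊔ Ideal.span {P i} := by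
  have span_le {k} (hik : i ≤ k) : A ⊔ Ideal.span {P k} ≤ A ⊔ Ideal.span {P i} :=
    sup_le_sup_left (Ideal.span_singleton_le_span_singleton.2 (h.dvd_of_le hik)) _
  have P_mem : P j ∈ A ⊔ Ideal.span {P i} :=
    span_le hij (Ideal.mem_sup_right (Ideal.mem_span_singleton_self _))
  induction j using Fin.lastCases with
  | last => simpa using add_mem (Ideal.mem_sup_left h.last_sub_mem) P_mem
  | cast j =>
    simpa using add_mem (span_le (hij.trans j.castSucc_lt_succ.le) (h.sub_mul_mem j))
      (Ideal.mul_mem_right (q j) _ P_mem)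

theorem isSMulRegular (h : IsTriangularPresentation A w M P q) (i : Fin (n + 1)) :
    IsSMulRegular (R ⧸ A) (P i) := by
  obtain ⟨c, hc⟩ := h.dvd_of_le i.le_last
  exact IsSMulRegular.of_mul (a := c) (by simpa [mul_comm c, ← hc] using h.isSMulRegular_last)

theorem sub_vecMul_dotProduct_mem (h : IsTriangularPresentation A w M P q) {t : Fin (n + 1) → R}
    (ht : t ⬝ᵥ w ∈ A) (l : Fin n → R) : (t - l ᵥ* M) ⬝ᵥ w ∈ A := by
  rwa [sub_dotProduct, ← dotProduct_mulVec, h.mulVec_eq_zero, dotProduct_zero, sub_zero]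

theorem exists_sub_mem_of_forall_lt (h : IsTriangularPresentation A w M P q)
    {t : Fin (n + 1) → R} (ht : t ⬝ᵥ w ∈ A) (i : Fin n) (hlt : ∀ j < i.castSucc, t j ∈ A) :
    ∃ s, t i.castSucc - M i i.castSucc * s ∈ A := by
  have hmem : t i.castSucc * w i.castSucc ∈ A ⊔ Ideal.span {P i.succ} := by
    refine mul_mem_of_dotProduct_mem (Ideal.mem_sup_left ht) _ fun j hj => ?_
    rcases hj.lt_or_gt with hj | hj
    · exact Ideal.mul_mem_right _ _ (Ideal.mem_sup_left (hlt j hj))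
    · exact Ideal.mul_mem_left _ _ (h.mem_sup_span_of_le (Fin.castSucc_lt_iff_succ_le.1 hj))
  have hmem' : t i.castSucc * (P i.castSucc * q i) ∈ A ⊔ Ideal.span {P i.succ} := by
    simpa [mul_sub] using sub_mem hmem (Ideal.mul_mem_left _ (t i.castSucc) (h.sub_mul_mem i))
  obtain ⟨s, hs⟩ := mem_sup_span_singleton_iff.1 hmem'
  refine mem_sup_span_singleton_iff.1 (mem_of_mul_mem (h.isSMulRegular_cofactor i) ?_)
  refine mem_sup_span_singleton_iff.2 ⟨s, mem_of_mul_mem (h.isSMulRegular i.castSucc) ?_⟩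
  convert! hs using 1
  rw [h.succ_eq_mul]
  ring

theorem exists_sub_vecMul_mem (h : IsTriangularPresentation A w M P q) {t : Fin (n + 1) → R}
    (ht : t ⬝ᵥ w ∈ A) : ∃ l : Fin n → R, ∀ j, (t - l ᵥ* M) j ∈ A := by
  have eliminate (i : Fin (n + 1)) : ∃ l : Fin n → R, ∀ j < i, (t - l ᵥ* M) j ∈ A := by
    induction i using Fin.induction with
    | zero => exact ⟨0, fun j hj => absurd hj (Fin.not_lt_zero j)⟩
    | succ i ih =>
      obtain ⟨l, hl⟩ := ih
      obtain ⟨s, hs⟩ := h.exists_sub_mem_of_forall_lt (h.sub_vecMul_dotProduct_mem ht l) i hl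
      refine ⟨l + Pi.single i s, fun j hj => ?_⟩
      have hsub : (t - (l + Pi.single i s) ᵥ* M) j = (t - l ᵥ* M) j - M i j * s := by
        simp [add_vecMul, single_vecMul, sub_sub, mul_comm]
      rw [hsub]
      rcases (Fin.le_castSucc_iff.2 hj).lt_or_eq with hj | rfl
      · exact sub_mem (hl j hj) (Ideal.mul_mem_right _ _ (h.mem_of_lt i j hj))
      · exact hs
  obtain ⟨l, hl⟩ := eliminate (Fin.last n)
  refine ⟨l, fun j => ?_⟩
  rcases j.le_last.lt_or_eq with hj | rfl
  · exact hl j hj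
  refine mem_of_mul_mem (h.isSMulRegular (Fin.last n)) ?_
  have hmem : (t - l ᵥ* M) (Fin.last n) * w (Fin.last n) ∈ A :=
    mul_mem_of_dotProduct_mem (h.sub_vecMul_dotProduct_mem ht l) _ fun j hj =>
      Ideal.mul_mem_right _ _ (hl j (Fin.lt_last_iff_ne_last.2 hj))
  rw [mul_comm]
  simpa [mul_sub] using
    sub_mem hmem (Ideal.mul_mem_left _ ((t - l ᵥ* M) (Fin.last n)) h.last_sub_mem)

variable {a : R}

theorem exists_eq_vecMul_add_smul (h : IsTriangularPresentation (Ideal.span {a}) w M P q)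
    {t : Fin (n + 1) → R} (ht : a ∣ t ⬝ᵥ w) : ∃ l e, t = l ᵥ* M + a • e := by
  obtain ⟨l, hl⟩ := h.exists_sub_vecMul_mem (Ideal.mem_span_singleton.2 ht)
  choose e he using fun j => Ideal.mem_span_singleton.1 (hl j)
  exact ⟨l, e, funext fun j => by simp [← he]⟩

theorem vecMul_add_smul_dotProduct (h : IsTriangularPresentation A w M P q) (l : Fin n → R)
    (e : Fin (n + 1) → R) : (l ᵥ* M + a • e) ⬝ᵥ w = a * e ⬝ᵥ w := by
  rw [add_dotProduct, ← dotProduct_mulVec, h.mulVec_eq_zero, dotProduct_zero, zero_add,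
    smul_dotProduct, smul_eq_mul]

theorem isSMulRegular_quotient_span_range (ha : IsSMulRegular R a)
    (h : IsTriangularPresentation (Ideal.span {a}) w M P q) :
    IsSMulRegular (R ⧸ Ideal.span (Set.range w)) a := by
  rw [isSMulRegular_quotient_iff_mem_of_smul_mem]
  intro s hs
  obtain ⟨t, ht⟩ := Ideal.mem_span_range_iff_exists_fun.1 hs
  obtain ⟨l, e, rfl⟩ := h.exists_eq_vecMul_add_smul (t := t) ⟨s, ht⟩
  exact Ideal.mem_span_range_iff_exists_fun.2
    ⟨e, ha ((h.vecMul_add_smul_dotProduct l e).symm.trans ht)⟩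

theorem mem_span_sup_span_pow_of_dotProduct_eq_zero (ha : IsSMulRegular R a)
    (h : IsTriangularPresentation (Ideal.span {a}) w M P q) (j : Fin (n + 1)) (m : ℕ)
    {t : Fin (n + 1) → R} (ht : t ⬝ᵥ w = 0) :
    t j ∈ Ideal.span (Set.range fun i => M i j) ⊔ Ideal.span {a ^ m} := by
  induction m generalizing t with
  | zero => simp
  | succ m ih =>
    obtain ⟨l, e, rfl⟩ := h.exists_eq_vecMul_add_smul (ht ▸ dvd_zero a)
    rw [h.vecMul_add_smul_dotProduct] at ht
    have he := ih (ha (ht.trans (mul_zero a).symm))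
    have hl : (l ᵥ* M) j ∈ Ideal.span (Set.range fun i => M i j) :=
      Ideal.mem_span_range_iff_exists_fun.2 ⟨l, rfl⟩
    obtain ⟨s, hs⟩ := mem_sup_span_singleton_iff.1 he
    refine mem_sup_span_singleton_iff.2 ⟨s, ?_⟩
    convert! add_mem hl (Ideal.mul_mem_left _ a hs) using 1
    simp only [Pi.add_apply, Pi.smul_apply, smul_eq_mul]
    ring

theorem colon_eq_span (ha : IsSMulRegular R a)
    (h : IsTriangularPresentation (Ideal.span {a}) w M P q) (j : Fin (n + 1)) {m : ℕ}
    (hm : a ^ m ∈ Ideal.span (Set.range fun i => M i j)) :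
    (Ideal.span (w '' {j}ᶜ)).colon {w j} = Ideal.span (Set.range fun i => M i j) := by
  apply le_antisymm
  · intro s hs
    rw [Submodule.mem_colon_singleton, smul_eq_mul] at hs
    obtain ⟨t, ht, htj⟩ := exists_dotProduct_eq_zero_of_mul_mem_span hs
    refine sup_le le_rfl ((Ideal.span_singleton_le_iff_mem _).2 hm) ?_
    exact htj ▸ h.mem_span_sup_span_pow_of_dotProduct_eq_zero ha j m ht
  · rw [Ideal.span_le]
    rintro _ ⟨i, rfl⟩
    have hrow : M i ⬝ᵥ w = 0 := congrFun h.mulVec_eq_zero i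
    rw [SetLike.mem_coe, Submodule.mem_colon_singleton]
    refine mul_mem_of_dotProduct_mem (hrow ▸ zero_mem _) j fun k hk => ?_
    exact Ideal.mul_mem_left _ _ (Ideal.subset_span ⟨k, hk, rfl⟩)

end IsTriangularPresentation

end Syzygies

section Length

variable {R : Type*} [CommRing R]

theorem length_quotient_eq_add (L : Ideal R) (w : R) :
    Module.length R (R ⧸ L) =
      Module.length R (R ⧸ L ⊔ Ideal.span {w}) + Module.length R (R ⧸ L.colon {w}) := by
  have colon_eq : L.colon {w} = Submodule.comap (LinearMap.mulRight R w) L := by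
    ext t
    simp [Submodule.mem_colon_singleton]
  rw [colon_eq, add_comm]
  refine Module.length_eq_add_of_exact
    (Submodule.mapQ (Submodule.comap (LinearMap.mulRight R w) L) L (LinearMap.mulRight R w) le_rfl)
    (Submodule.factor (le_sup_left : L ≤ L ⊔ Ideal.span {w})) ?_ (Submodule.factor_surjective _) ?_
  · rw [← LinearMap.ker_eq_bot, Submodule.ker_mapQ, Submodule.mkQ_map_self]
  · intro t
    obtain ⟨t, rfl⟩ := Submodule.mkQ_surjective _ t
    have factor_eq_zero : Submodule.factor (le_sup_left : L ≤ L ⊔ Ideal.span {w}) (L.mkQ t) = 0 ↔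
        t ∈ L ⊔ Ideal.span {w} := Submodule.Quotient.mk_eq_zero _
    rw [factor_eq_zero, mem_sup_span_singleton_iff]
    constructor
    · rintro ⟨s, hs⟩
      refine ⟨Submodule.Quotient.mk s, ((Submodule.Quotient.eq _).2 ?_).symm⟩
      simpa [mul_comm] using hs
    · rintro ⟨s, hs⟩
      obtain ⟨s, rfl⟩ := Submodule.mkQ_surjective _ s
      exact ⟨s, by simpa [mul_comm] using (Submodule.Quotient.eq _).1 hs.symm⟩

theorem quotientLength_sup_span (L : Ideal R) (w : R) :
    quotientLength (L ⊔ Ideal.span {w}) L = Module.length R (R ⧸ L.colon {w}) := by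
  let φ : R →ₗ[R] (L ⊔ Ideal.span {w} : Ideal R) :=
    LinearMap.toSpanSingleton R _ ⟨w, Ideal.mem_sup_right (Ideal.mem_span_singleton_self w)⟩
  let ψ := (Submodule.submoduleOf L (L ⊔ Ideal.span {w})).mkQ ∘ₗ φ
  have ker_eq : L.colon {w} = LinearMap.ker ψ := by
    ext t
    rw [Submodule.mem_colon_singleton, LinearMap.mem_ker]
    exact (Submodule.Quotient.mk_eq_zero (Submodule.submoduleOf L (L ⊔ Ideal.span {w}))
      (x := φ t)).symm
  have surjective : Function.Surjective ψ := by
    intro t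
    obtain ⟨⟨t, ht⟩, rfl⟩ := Submodule.mkQ_surjective _ t
    obtain ⟨s, hs⟩ := mem_sup_span_singleton_iff.1 ht
    refine ⟨s, ((Submodule.Quotient.eq _).2 ?_).symm⟩
    change t - s * w ∈ L
    rwa [mul_comm]
  rw [ker_eq]
  exact (LinearMap.quotKerEquivOfSurjective ψ surjective).length_eq.symm

variable {L : Ideal R} {p : R}

theorem colon_sup_span_singleton_mul (hp : IsSMulRegular (R ⧸ L) p) (B : Ideal R) :
    (L ⊔ Ideal.span {p} * B).colon {p} = L ⊔ B := by
  ext t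
  rw [Submodule.mem_colon_singleton, smul_eq_mul, mul_comm t]
  constructor <;> intro h
  · obtain ⟨s, hs, _, ht, hst⟩ := Submodule.mem_sup.1 h
    obtain ⟨r, hr, rfl⟩ := Ideal.mem_span_singleton_mul.1 ht
    have mul_eq : p * (t - r) = s := by rw [mul_sub, ← hst, add_sub_cancel_right]
    rw [← sub_add_cancel t r]
    exact add_mem (Ideal.mem_sup_left (mem_of_mul_mem hp (mul_eq ▸ hs))) (Ideal.mem_sup_right hr)
  · obtain ⟨s, hs, r, hr, rfl⟩ := Submodule.mem_sup.1 h
    rw [mul_add]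
    exact add_mem (Ideal.mem_sup_left (L.mul_mem_left p hs))
      (Ideal.mem_sup_right (Ideal.mem_span_singleton_mul.2 ⟨r, hr, rfl⟩))

theorem length_quotient_sup_span_singleton_mul (hp : IsSMulRegular (R ⧸ L) p) (B : Ideal R) :
    Module.length R (R ⧸ L ⊔ Ideal.span {p} * B) =
      Module.length R (R ⧸ L ⊔ Ideal.span {p}) + Module.length R (R ⧸ L ⊔ B) := by
  rw [length_quotient_eq_add _ p, colon_sup_span_singleton_mul hp, sup_assoc,
    sup_eq_right.2 (Ideal.mul_le_left (I := Ideal.span {p}))]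

theorem length_quotient_sup_span_pow (hp : IsSMulRegular (R ⧸ L) p) (n : ℕ) :
    Module.length R (R ⧸ L ⊔ Ideal.span {p ^ n}) =
      n * Module.length R (R ⧸ L ⊔ Ideal.span {p}) := by
  induction n with
  | zero =>
    have : Subsingleton (R ⧸ L ⊔ Ideal.span {p ^ 0}) := Ideal.Quotient.subsingleton_iff.2 (by simp)
    rw [Module.length_eq_zero, Nat.cast_zero, zero_mul]
  | succ n ih =>
    rw [pow_succ', ← Ideal.span_singleton_mul_span_singleton,
      length_quotient_sup_span_singleton_mul hp, ih, Nat.cast_succ, add_one_mul, add_comm]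

theorem length_quotient_sq_sq_sq_mul {a b c : R}
    (ha : IsSMulRegular (R ⧸ Ideal.span {b ^ 2} ⊔ Ideal.span {c ^ 2}) a)
    (hb : IsSMulRegular (R ⧸ Ideal.span {a} ⊔ Ideal.span {c ^ 2}) b)
    (hc : IsSMulRegular (R ⧸ Ideal.span {a} ⊔ Ideal.span {b}) c) :
    Module.length R (R ⧸ Ideal.span {a ^ 2, b ^ 2, c ^ 2, a * b * c}) =
      7 * Module.length R (R ⧸ Ideal.span {a, b, c}) := by
  have span_eq_a : Ideal.span {a ^ 2, b ^ 2, c ^ 2, a * b * c} =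
      Ideal.span {b ^ 2} ⊔ Ideal.span {c ^ 2} ⊔ Ideal.span {a} * Ideal.span {a, b * c} := by
    simp only [Ideal.span_insert, Ideal.mul_sup, Ideal.span_singleton_mul_span_singleton, pow_two,
      mul_assoc]
    order
  have span_eq_b : Ideal.span {b ^ 2} ⊔ Ideal.span {c ^ 2} ⊔ Ideal.span {a, b * c} =
      Ideal.span {a} ⊔ Ideal.span {c ^ 2} ⊔ Ideal.span {b} * Ideal.span {b, c} := by
    simp only [Ideal.span_insert, Ideal.mul_sup, Ideal.span_singleton_mul_span_singleton, pow_two]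
    order
  have span_eq_b_sq : Ideal.span {b ^ 2} ⊔ Ideal.span {c ^ 2} ⊔ Ideal.span {a} =
      Ideal.span {a} ⊔ Ideal.span {c ^ 2} ⊔ Ideal.span {b ^ 2} := by
    order
  have span_eq_c_sq : Ideal.span {a} ⊔ Ideal.span {c ^ 2} ⊔ Ideal.span {b} =
      Ideal.span {a} ⊔ Ideal.span {b} ⊔ Ideal.span {c ^ 2} := by
    order
  have span_eq : Ideal.span {a} ⊔ Ideal.span {c ^ 2} ⊔ Ideal.span {b, c} =
      Ideal.span {a, b, c} := by
    have c_sq_le : Ideal.span {c ^ 2} ≤ Ideal.span {c} :=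
      Ideal.span_singleton_le_span_singleton.2 (dvd_pow_self c two_ne_zero)
    simp only [Ideal.span_insert]
    order
  have span_eq' : Ideal.span {a} ⊔ Ideal.span {b} ⊔ Ideal.span {c} = Ideal.span {a, b, c} := by
    simp only [Ideal.span_insert, sup_assoc]
  rw [span_eq_a, length_quotient_sup_span_singleton_mul ha, span_eq_b_sq, span_eq_b,
    length_quotient_sup_span_singleton_mul hb, length_quotient_sup_span_pow hb, span_eq_c_sq,
    length_quotient_sup_span_pow hc, span_eq, span_eq', Nat.cast_ofNat]
  ring

end Length

section SystemOfParameters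

open IsLocalRing RingTheory.Sequence

theorem IsSystemOfParameters.radical_span_eq {R : Type*} [CommRing R] [IsLocalRing R] {x y z : R}
    (h : IsSystemOfParameters ![x, y, z]) :
    (Ideal.span {x, y, z}).radical = maximalIdeal R := by
  rw [← h.2, Matrix.range_cons, Matrix.range_cons_cons_empty, Set.singleton_union]

theorem isWeaklyRegular_triple_iff {R : Type*} [CommRing R] {p q r : R} :
    IsWeaklyRegular R [p, q, r] ↔ IsSMulRegular R p ∧ IsSMulRegular (R ⧸ Ideal.span {p}) q ∧
      IsSMulRegular (R ⧸ Ideal.span {p} ⊔ Ideal.span {q}) r := by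
  have append_eq : [p, q, r] = [p] ++ [q] ++ [r] := rfl
  have ofList_pair : Ideal.ofList ([p] ++ [q]) = Ideal.span {p} ⊔ Ideal.span {q} := by
    rw [Ideal.ofList_append, Ideal.ofList_singleton, Ideal.ofList_singleton]
  rw [append_eq, isWeaklyRegular_append_iff, isWeaklyRegular_append_iff, ofList_pair,
    Ideal.ofList_singleton, isWeaklyRegular_singleton_iff, isWeaklyRegular_singleton_iff,
    isWeaklyRegular_singleton_iff, smul_eq_mul, smul_eq_mul, Ideal.mul_top, Ideal.mul_top,
    and_assoc]

variable {R : Type*} [CommRing R] [IsLocalRing R] [IsNoetherianRing R] {x y z : R}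

theorem isWeaklyRegular_pow (hdepth : 3 ≤ moduleDepth R R)
    (h : (Ideal.span {x, y, z}).radical = maximalIdeal R) {i j k : ℕ} (hi : 0 < i) (hj : 0 < j)
    (hk : 0 < k) : IsWeaklyRegular R [x ^ i, y ^ j, z ^ k] := by
  have mem (t : R) (ht : t ∈ ({x, y, z} : Set R)) : t ∈ maximalIdeal R :=
    h ▸ Ideal.le_radical (Ideal.subset_span ht)
  refine isWeaklyRegular_of_length_le_moduleDepth ?_ ?_ (by simpa using hdepth)
  · simp only [List.mem_cons, List.not_mem_nil, or_false]
    rintro _ (rfl | rfl | rfl)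
    exacts [Ideal.pow_mem_of_mem _ (mem x (by simp)) i hi,
      Ideal.pow_mem_of_mem _ (mem y (by simp)) j hj, Ideal.pow_mem_of_mem _ (mem z (by simp)) k hk]
  · rw [← h, Ideal.radical_le_radical_iff, Ideal.span_le]
    have mem_radical {t : R} {l : ℕ} (ht : t ^ l ∈ [x ^ i, y ^ j, z ^ k]) :
        t ∈ (Module.annihilator R R ⊔ Ideal.ofList [x ^ i, y ^ j, z ^ k]).radical :=
      ⟨l, Ideal.mem_sup_right (Ideal.subset_span ht)⟩
    rintro _ (rfl | rfl | rfl)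
    exacts [mem_radical (l := i) (by simp), mem_radical (l := j) (by simp),
      mem_radical (l := k) (by simp)]

theorem isSMulRegular_quotient_span_pow_sup_span_pow (hdepth : 3 ≤ moduleDepth R R)
    (h : (Ideal.span {x, y, z}).radical = maximalIdeal R) (i j k : ℕ) :
    IsSMulRegular (R ⧸ Ideal.span {x ^ i} ⊔ Ideal.span {y ^ j}) (z ^ k) := by
  by_cases hij : 0 < i ∧ 0 < j
  · have := (isWeaklyRegular_triple_iff.1
      (isWeaklyRegular_pow hdepth h hij.1 hij.2 one_pos)).2.2
    rw [pow_one] at this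
    exact this.pow k
  · have : Subsingleton (R ⧸ Ideal.span {x ^ i} ⊔ Ideal.span {y ^ j}) := by
      rw [Ideal.Quotient.subsingleton_iff]
      rcases i.eq_zero_or_pos with rfl | hi
      · simp
      · obtain rfl : j = 0 := by omega
        simp
    exact fun _ _ _ => Subsingleton.elim _ _

theorem length_quotient_span_pow_pow_pow (hdepth : 3 ≤ moduleDepth R R)
    (h : (Ideal.span {x, y, z}).radical = maximalIdeal R) (i j k : ℕ) :
    Module.length R (R ⧸ Ideal.span {x ^ i, y ^ j, z ^ k}) =
      i * j * k * Module.length R (R ⧸ Ideal.span {x, y, z}) := by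
  have hyzx : (Ideal.span {y, z, x}).radical = maximalIdeal R := by
    rw [← h, Set.insert_comm x, Set.pair_comm x]
  have hxzy : (Ideal.span {x, z, y}).radical = maximalIdeal R := by
    rw [← h, Set.pair_comm]
  have hz : IsSMulRegular (R ⧸ Ideal.span {x ^ i} ⊔ Ideal.span {y ^ j}) z := by
    simpa only [pow_one] using isSMulRegular_quotient_span_pow_sup_span_pow hdepth h i j 1
  have hy : IsSMulRegular (R ⧸ Ideal.span {x ^ i} ⊔ Ideal.span {z}) y := by
    have := isSMulRegular_quotient_span_pow_sup_span_pow hdepth hxzy i 1 1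
    rwa [pow_one, pow_one] at this
  have hx : IsSMulRegular (R ⧸ Ideal.span {y} ⊔ Ideal.span {z}) x := by
    have := isSMulRegular_quotient_span_pow_sup_span_pow hdepth hyzx 1 1 1
    rwa [pow_one, pow_one, pow_one] at this
  rw [Ideal.span_insert, Ideal.span_insert, ← sup_assoc, length_quotient_sup_span_pow hz,
    sup_right_comm, length_quotient_sup_span_pow hy, sup_assoc, sup_comm, sup_comm (Ideal.span {z}),
    length_quotient_sup_span_pow hx, sup_comm, ← Ideal.span_insert, ← Ideal.span_insert]
  ring

end SystemOfParameters

section SymbolicPower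

open IsLocalRing Module

variable {R : Type*} [CommRing R] {I J : Ideal R}

theorem mem_symbolicPower_iff {n : ℕ} {t : R} :
    t ∈ symbolicPower I n ↔ ∀ p ∈ I.minimalPrimes, ∃ s ∉ p, s * t ∈ I ^ n := by
  simp only [symbolicPower, Ideal.mem_iInf, Ideal.mem_comap]
  refine ⟨fun h p hp => ?_, fun h p hp => ?_⟩
  · have hs := h ⟨p, hp.1.1⟩ hp
    have := hp.1.1
    rwa [IsLocalization.algebraMap_mem_map_algebraMap_iff p.primeCompl] at hs
  · rw [IsLocalization.algebraMap_mem_map_algebraMap_iff p.asIdeal.primeCompl]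
    exact h p.asIdeal hp

variable [IsLocalRing R] [IsNoetherianRing R] {x : R}

theorem mem_minimalPrimes_of_notMem (hx : x ∈ maximalIdeal R)
    (hrad : maximalIdeal R ≤ (I ⊔ Ideal.span {x}).radical) {P : Ideal R} [hP : P.IsPrime]
    (hIP : I ≤ P) (hxP : x ∉ P) : P ∈ I.minimalPrimes := by
  have ringKrullDim_quotient_le : ringKrullDim (R ⧸ I) ≤ 1 := by
    rw [← supportDim_quotient_eq_ringKrullDim]
    exact supportDim_le_length (rs := [x]) (by simpa using hx)
      (by rwa [Ideal.annihilator_quotient, Ideal.ofList_singleton])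
  have : Ring.KrullDimLE 1 (R ⧸ I) := Ring.krullDimLE_iff.2 ringKrullDim_quotient_le
  have comap_map : (P.map (Ideal.Quotient.mk I)).comap (Ideal.Quotient.mk I) = P := by
    rw [Ideal.comap_map_of_surjective _ Ideal.Quotient.mk_surjective, ← RingHom.ker,
      Ideal.mk_ker, sup_eq_left.2 hIP]
  have isPrime_map : (P.map (Ideal.Quotient.mk I)).IsPrime :=
    Ideal.map_isPrime_of_surjective Ideal.Quotient.mk_surjective (by rwa [Ideal.mk_ker])
  rcases Ring.krullDimLE_one_iff.1 this _ isPrime_map with hmin | hmax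
  · rw [Ideal.minimalPrimes_eq_comap]
    exact ⟨_, hmin, comap_map⟩
  · have := Ideal.comap_isMaximal_of_surjective (Ideal.Quotient.mk I)
      Ideal.Quotient.mk_surjective (K := P.map (Ideal.Quotient.mk I))
    rw [comap_map] at this
    exact absurd (eq_maximalIdeal this ▸ hx) hxP

theorem symbolicPower_eq {n : ℕ} (hx : x ∈ maximalIdeal R)
    (hrad : maximalIdeal R ≤ (I ⊔ Ideal.span {x}).radical) (hI : IsSMulRegular (R ⧸ I) x)
    (hJ : IsSMulRegular (R ⧸ J) x) (hle : I ^ n ≤ J) (htor : ∀ t ∈ J, ∃ k : ℕ, x ^ k * t ∈ I ^ n) :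
    symbolicPower I n = J := by
  have notMem (p : Ideal R) (hp : p ∈ I.minimalPrimes) : x ∉ p := fun hxp => by
    obtain ⟨y, hy, hxy⟩ := Ideal.exists_mul_mem_of_mem_minimalPrimes hp hxp
    exact hy (mem_of_mul_mem hI hxy)
  apply le_antisymm <;> intro t ht
  · have mem_radical : x ∈ ((I ^ n).colon {t}).radical := by
      rw [Ideal.radical_eq_sInf, Ideal.mem_sInf]
      rintro P ⟨hP, _⟩
      by_contra hxP
      have hIP : I ≤ P := Ideal.IsPrime.le_of_pow_le (n := n) fun s hs =>
        hP (Submodule.mem_colon_singleton.2 (Ideal.mul_mem_right t _ hs))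
      obtain ⟨s, hs, hst⟩ := mem_symbolicPower_iff.1 ht P
        (mem_minimalPrimes_of_notMem hx hrad hIP hxP)
      exact hs (hP (Submodule.mem_colon_singleton.2 hst))
    obtain ⟨k, hk⟩ := mem_radical
    exact mem_of_mul_mem (hJ.pow k) (hle (Submodule.mem_colon_singleton.1 hk))
  · refine mem_symbolicPower_iff.2 fun p hp => ?_
    obtain ⟨k, hk⟩ := htor t ht
    exact ⟨x ^ k, fun h => notMem p hp (hp.1.1.mem_of_pow_mem _ h), hk⟩

end SymbolicPower

section RegularElements

variable {R : Type*} [CommRing R] {A : Ideal R}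

theorem isSMulRegular_quotient_sup_span_mul {p q r : R} (hp : IsSMulRegular (R ⧸ A) p)
    (hrp : IsSMulRegular (R ⧸ A ⊔ Ideal.span {p}) r)
    (hrq : IsSMulRegular (R ⧸ A ⊔ Ideal.span {q}) r) :
    IsSMulRegular (R ⧸ A ⊔ Ideal.span {p * q}) r := by
  rw [isSMulRegular_quotient_iff_mem_of_smul_mem]
  intro t ht
  obtain ⟨w, hw⟩ := mem_sup_span_singleton_iff.1 ht
  have htp : t ∈ A ⊔ Ideal.span {p} :=
    mem_of_mul_mem hrp (mem_sup_span_singleton_iff.2 ⟨q * w, by rwa [← mul_assoc]⟩)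
  obtain ⟨s, hs⟩ := mem_sup_span_singleton_iff.1 htp
  have hsq : r * s - q * w ∈ A := by
    refine mem_of_mul_mem hp ?_
    convert! sub_mem hw (A.mul_mem_left r hs) using 1
    simp only [smul_eq_mul]
    ring
  obtain ⟨k, hk⟩ := mem_sup_span_singleton_iff.1
    (mem_of_mul_mem hrq (mem_sup_span_singleton_iff.2 ⟨w, hsq⟩))
  refine mem_sup_span_singleton_iff.2 ⟨k, ?_⟩
  convert! add_mem hs (A.mul_mem_left p hk) using 1
  ring

theorem isSMulRegular_quotient_sup_span_of_mem_closure {S : Set R}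
    (hS : ∀ p ∈ S, IsSMulRegular (R ⧸ A) p) {r : R}
    (hr : ∀ p ∈ S, IsSMulRegular (R ⧸ A ⊔ Ideal.span {p}) r) {p : R}
    (hp : p ∈ Submonoid.closure S) :
    IsSMulRegular (R ⧸ A) p ∧ IsSMulRegular (R ⧸ A ⊔ Ideal.span {p}) r := by
  induction hp using Submonoid.closure_induction with
  | mem p hp => exact ⟨hS p hp, hr p hp⟩
  | one =>
    rw [Ideal.span_singleton_one, sup_top_eq]
    exact ⟨.one _, fun _ _ _ => Subsingleton.elim _ _⟩
  | mul p q _ _ hp hq =>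
    exact ⟨hp.1.mul hq.1, isSMulRegular_quotient_sup_span_mul hp.1 hp.2 hq.2⟩

theorem span_pow_three_le_iff {S : Set R} :
    Ideal.span S ^ 3 ≤ A ↔ ∀ p ∈ S, ∀ q ∈ S, ∀ r ∈ S, p * (q * r) ∈ A := by
  rw [pow_three, Ideal.span_mul_span', Ideal.span_mul_span', Ideal.span_le]
  simp only [Set.mul_subset_iff, Set.mem_mul, SetLike.mem_coe, forall_exists_index, and_imp]
  exact forall₂_congr fun p _ => ⟨fun h q hq r hr => h _ q hq r hr rfl,
    fun h _ q hq r hr e => e ▸ h q hq r hr⟩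

end RegularElements

theorem maximalMinorsIdeal_two_three {R : Type*} [CommRing R] (A : Matrix (Fin 2) (Fin 3) R) :
    maximalMinorsIdeal A = Ideal.span {A 0 1 * A 1 2 - A 0 2 * A 1 1,
      A 0 0 * A 1 2 - A 0 2 * A 1 0, A 0 0 * A 1 1 - A 0 1 * A 1 0} := by
  have hdet : ∀ e : Fin 2 ↪o Fin 3, (A.submatrix id e).det =
      A 0 (e 0) * A 1 (e 1) - A 0 (e 1) * A 1 (e 0) := fun e => by
    rw [Matrix.det_fin_two]; rfl
  refine le_antisymm (Ideal.span_le.2 ?_) (Ideal.span_le.2 ?_)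
  · rintro _ ⟨e, rfl⟩
    refine Ideal.subset_span ?_
    have hlt : e 0 < e 1 := e.strictMono (by decide)
    simp only [hdet]
    generalize e 0 = i at *
    generalize e 1 = j at *
    fin_cases i <;> fin_cases j <;> simp at hlt ⊢
  · rintro _ (rfl | rfl | rfl)
    · exact Ideal.subset_span
        ⟨OrderEmbedding.ofStrictMono ![1, 2] (by decide), (hdet _).trans (by simp)⟩
    · exact Ideal.subset_span
        ⟨OrderEmbedding.ofStrictMono ![0, 2] (by decide), (hdet _).trans (by simp)⟩
    · exact Ideal.subset_span
        ⟨OrderEmbedding.ofStrictMono ![0, 1] (by decide), (hdet _).trans (by simp)⟩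

/-- The matrix with rows `(a, b, c)` and `(u * b ^ 2, v * c ^ 2, a ^ 2)`. -/
structure CyclicMatrix (R : Type*) where
  (a b c u v : R)

namespace CyclicMatrix

open IsLocalRing Matrix

variable {R : Type*} [CommRing R] (X : CyclicMatrix R)

/-- The minor omitting the first column, in characteristic two. -/
def f : R := X.v * X.c ^ 3 + X.a ^ 2 * X.b

/-- The minor omitting the second column, in characteristic two. -/
def g : R := X.u * X.b ^ 2 * X.c + X.a ^ 3

/-- The minor omitting the third column, in characteristic two. -/
def h : R := X.u * X.b ^ 3 + X.a * X.v * X.c ^ 2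

/-- The ideal `I` of maximal minors, in characteristic two. -/
def ideal : Ideal R := Ideal.span {X.f, X.g, X.h}

/-- The generator of the third symbolic power that is missing from `I ^ 3`: the quotient of
`u * f ^ 3 + g ^ 2 * h` by `c ^ 2`, and of `v * f ^ 2 * g + h ^ 3` by `b ^ 2`. -/
def d : R :=
  X.u * X.v * X.a ^ 4 * X.b ^ 2 * X.c + X.u * X.v ^ 2 * X.a ^ 2 * X.b * X.c ^ 4
    + X.u * X.v ^ 3 * X.c ^ 7 + X.v * X.a ^ 7 + X.u ^ 3 * X.b ^ 7
    + X.u ^ 2 * X.v * X.a * X.b ^ 4 * X.c ^ 2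

theorem ideal_le : X.ideal ≤ Ideal.span {X.a, X.b, X.c} := by
  have a_mem : X.a ∈ Ideal.span {X.a, X.b, X.c} := Ideal.subset_span (by simp)
  have b_mem : X.b ∈ Ideal.span {X.a, X.b, X.c} := Ideal.subset_span (by simp)
  have c_mem : X.c ∈ Ideal.span {X.a, X.b, X.c} := Ideal.subset_span (by simp)
  rw [ideal, Ideal.span_le]
  rintro _ (rfl | rfl | rfl)
  · exact add_mem (Ideal.mul_mem_left _ _ (Ideal.pow_mem_of_mem _ c_mem 3 three_pos))
      (Ideal.mul_mem_left _ _ b_mem)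
  · exact add_mem (Ideal.mul_mem_left _ _ c_mem) (Ideal.pow_mem_of_mem _ a_mem 3 three_pos)
  · exact add_mem (Ideal.mul_mem_left _ _ (Ideal.pow_mem_of_mem _ b_mem 3 three_pos))
      (Ideal.mul_mem_left _ _ (Ideal.pow_mem_of_mem _ c_mem 2 two_pos))

theorem span_le_ideal_sup_span_a :
    Ideal.span {X.a, X.u * X.b ^ 3, X.v * X.c ^ 3} ≤ X.ideal ⊔ Ideal.span {X.a} := by
  rw [Ideal.span_le]
  rintro _ (rfl | rfl | rfl)
  · exact Ideal.mem_sup_right (Ideal.mem_span_singleton_self _)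
  · refine mem_sup_span_singleton_iff.2 ⟨-(X.v * X.c ^ 2), ?_⟩
    convert! (Ideal.subset_span (by simp) : X.h ∈ X.ideal) using 1
    rw [h]
    ring
  · refine mem_sup_span_singleton_iff.2 ⟨-(X.a * X.b), ?_⟩
    convert! (Ideal.subset_span (by simp) : X.f ∈ X.ideal) using 1
    rw [f]
    ring

/-- The ideal `I ^ 3 : d`. -/
def conductor : Ideal R := Ideal.span {X.a ^ 2, X.b ^ 2, X.c ^ 2, X.a * X.b * X.c}

/-- The sequence `a, p, q` is regular for every `p ∈ {b, u}` and `q ∈ {c, v}`, except that the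
quotients may vanish. -/
structure IsRegular : Prop where
  regular_a : IsSMulRegular R X.a
  regular_b_u : ∀ p ∈ ({X.b, X.u} : Set R), IsSMulRegular (R ⧸ Ideal.span {X.a}) p
  regular_c_v : ∀ p ∈ ({X.b, X.u} : Set R), ∀ q ∈ ({X.c, X.v} : Set R),
    IsSMulRegular (R ⧸ Ideal.span {X.a} ⊔ Ideal.span {p}) q

variable {X} in
theorem IsRegular.isSMulRegular_monomials (hX : X.IsRegular) {p q : R} (i j k l : ℕ)
    (hp : p = X.u ^ i * X.b ^ j) (hq : q = X.v ^ k * X.c ^ l) :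
    IsSMulRegular (R ⧸ Ideal.span {X.a}) p ∧
      IsSMulRegular (R ⧸ Ideal.span {X.a} ⊔ Ideal.span {p}) q := by
  have mem_closure : p ∈ Submonoid.closure {X.b, X.u} :=
    hp ▸ mul_mem (pow_mem (Submonoid.subset_closure (by simp)) i)
      (pow_mem (Submonoid.subset_closure (by simp)) j)
  have regular_quotient (r : R) (hr : r ∈ ({X.c, X.v} : Set R)) :=
    isSMulRegular_quotient_sup_span_of_mem_closure hX.regular_b_u
      (fun p hp => hX.regular_c_v p hp r hr) mem_closure
  exact ⟨(regular_quotient X.c (by simp)).1,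
    hq ▸ ((regular_quotient X.v (by simp)).2.pow k).mul ((regular_quotient X.c (by simp)).2.pow l)⟩

/-- The ten generators of `I ^ 3`, with `d` inserted in position one. This order makes the matrix
`relations` upper triangular modulo `a`. -/
def cubics : Fin 11 → R :=
  ![X.f ^ 3, X.d, X.f ^ 2 * X.g, X.f ^ 2 * X.h, X.f * X.g ^ 2, X.f * X.g * X.h, X.f * X.h ^ 2,
    X.g ^ 3, X.g ^ 2 * X.h, X.g * X.h ^ 2, X.h ^ 3]

open scoped Pointwise in
theorem cubics_image_compl :
    X.cubics '' {1}ᶜ = ({X.f, X.g, X.h} : Set R) * ({X.f, X.g, X.h} * {X.f, X.g, X.h}) := by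
  apply Set.Subset.antisymm
  · rintro _ ⟨i, hi, rfl⟩
    simp only [Set.mem_mul, Set.mem_insert_iff, Set.mem_singleton_iff, exists_eq_or_imp,
      exists_eq_left]
    fin_cases i <;> first | exact absurd rfl hi | (simp [cubics]; grind)
  · rintro _ ⟨p, hp, _, ⟨q, hq, r, hr, rfl⟩, rfl⟩
    have : ∃ i, i ≠ 1 ∧ X.cubics i = p * (q * r) := by
      simp only [Fin.exists_fin_succ, cubics]
      rcases hp with rfl | rfl | rfl <;> rcases hq with rfl | rfl | rfl <;>
        rcases hr with rfl | rfl | rfl <;> simp <;> grind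
    exact this

theorem ideal_pow_three : X.ideal ^ 3 = Ideal.span (X.cubics '' {1}ᶜ) := by
  rw [cubics_image_compl, ideal, pow_three, Ideal.span_mul_span', Ideal.span_mul_span']

/-- The rows are relations between the entries of `cubics`. -/
def relations : Matrix (Fin 10) (Fin 11) R :=
  !![X.u, X.c ^ 2, 0, 0, 0, 0, 0, 0, 1, 0, 0;
     0, X.b ^ 2, X.v, 0, 0, 0, 0, 0, 0, 0, 1;
     X.a, 0, X.b, X.c, 0, 0, 0, 0, 0, 0, 0;
     0, X.a * X.b * X.c, 0, X.u * X.b, X.c * X.v, 0, 0, 0, 0, X.a, 0;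
     0, 0, X.a, 0, X.b, X.c, 0, 0, 0, 0, 0;
     0, 0, 0, X.a, 0, X.b, X.c, 0, 0, 0, 0;
     0, X.a ^ 2, 0, 0, 0, 0, X.u, X.v, 0, 0, 0;
     0, 0, 0, 0, X.a, 0, 0, X.b, X.c, 0, 0;
     0, 0, 0, 0, 0, X.a, 0, 0, X.b, X.c, 0;
     0, 0, 0, 0, 0, 0, X.a, 0, 0, X.b, X.c]

theorem mk_a : Ideal.Quotient.mk (Ideal.span {X.a}) X.a = 0 :=
  Ideal.Quotient.mk_singleton_self X.a

theorem relations_mem_of_lt (i : Fin 10) (j : Fin 11) (hij : j < i.castSucc) :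
    X.relations i j ∈ Ideal.span {X.a} := by
  rw [Ideal.mem_span_singleton]
  fin_cases i <;> fin_cases j <;>
    first
    | exact absurd hij (by decide)
    | simp [relations, mul_assoc, pow_two]

theorem span_range_relations_column :
    Ideal.span (Set.range fun i => X.relations i 1) = X.conductor := by
  rw [conductor]
  apply le_antisymm <;> rw [Ideal.span_le]
  · rintro _ ⟨i, rfl⟩
    fin_cases i <;> first | exact zero_mem _ | exact Ideal.subset_span (by simp [relations])
  · rintro _ (rfl | rfl | rfl | rfl)
    exacts [Ideal.subset_span ⟨6, rfl⟩, Ideal.subset_span ⟨1, rfl⟩, Ideal.subset_span ⟨0, rfl⟩,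
      Ideal.subset_span ⟨3, rfl⟩]

theorem span_range_cubics : Ideal.span (Set.range X.cubics) = X.ideal ^ 3 ⊔ Ideal.span {X.d} := by
  rw [ideal_pow_three, ← Ideal.span_union, ← Set.image_univ, ← Set.compl_union_self {(1 : Fin 11)},
    Set.image_union, Set.image_singleton]
  rfl

theorem span_pow_three_le_conductor : Ideal.span {X.a, X.b, X.c} ^ 3 ≤ X.conductor := by
  rw [span_pow_three_le_iff]
  intro p hp q hq r hr
  have sq_mem {s : R} (hs : s ∈ ({X.a, X.b, X.c} : Set R)) : s ^ 2 ∈ X.conductor := by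
    rcases hs with rfl | rfl | rfl <;> exact Ideal.subset_span (by simp)
  have mem_of_eq {s t : R} (hs : s ∈ ({X.a, X.b, X.c} : Set R)) (h : p * (q * r) = t * s ^ 2) :
      p * (q * r) ∈ X.conductor := h ▸ Ideal.mul_mem_left _ t (sq_mem hs)
  by_cases hpq : p = q
  · exact mem_of_eq (t := r) hq (by rw [hpq]; ring)
  by_cases hpr : p = r
  · exact mem_of_eq (t := q) hr (by rw [hpr]; ring)
  by_cases hqr : q = r
  · exact mem_of_eq (t := p) hr (by rw [hqr]; ring)
  · have prod_eq : p * (q * r) = X.a * X.b * X.c := by grind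
    exact prod_eq ▸ Ideal.subset_span (by simp)

section CharTwo

variable [CharP R 2]

theorem maximalMinorsIdeal_eq_ideal :
    maximalMinorsIdeal !![X.a, X.b, X.c; X.u * X.b ^ 2, X.v * X.c ^ 2, X.a ^ 2] = X.ideal := by
  have minor_one : X.b * X.a ^ 2 - X.c * (X.v * X.c ^ 2) = X.f := by
    rw [CharTwo.sub_eq_add, f]; ring
  have minor_two : X.a * X.a ^ 2 - X.c * (X.u * X.b ^ 2) = X.g := by
    rw [CharTwo.sub_eq_add, g]; ring
  have minor_three : X.a * (X.v * X.c ^ 2) - X.b * (X.u * X.b ^ 2) = X.h := by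
    rw [CharTwo.sub_eq_add, h]; ring
  rw [maximalMinorsIdeal_two_three, ideal, ← minor_one, ← minor_two, ← minor_three]
  rfl

theorem a_sq_mul_d : X.a ^ 2 * X.d = X.u * (X.f * X.h ^ 2) + X.v * X.g ^ 3 := by
  simp only [f, g, h, d]
  grind

theorem b_sq_mul_d : X.b ^ 2 * X.d = X.v * (X.f ^ 2 * X.g) + X.h ^ 3 := by
  simp only [f, g, h, d]
  grind

theorem c_sq_mul_d : X.c ^ 2 * X.d = X.u * X.f ^ 3 + X.g ^ 2 * X.h := by
  simp only [f, g, h, d]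
  grind

theorem a_mul_b_mul_c_mul_d : X.a * X.b * X.c * X.d = X.u * X.b * (X.f ^ 2 * X.h)
    + X.c * X.v * (X.f * X.g ^ 2) + X.a * (X.g * X.h ^ 2) := by
  simp only [f, g, h, d]
  grind

theorem first_row_relation : X.a * X.f + X.b * X.g + X.c * X.h = 0 := by
  simp only [f, g, h]
  grind

theorem second_row_relation :
    X.u * X.b ^ 2 * X.f + X.v * X.c ^ 2 * X.g + X.a ^ 2 * X.h = 0 := by
  simp only [f, g, h]
  grind

theorem isTriangularPresentation_minors (hX : X.IsRegular) :
    IsTriangularPresentation (Ideal.span {X.a}) ![X.f, X.g, X.h]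
      !![X.u * X.b ^ 2, X.v * X.c ^ 2, X.a ^ 2; X.a, X.b, X.c]
      ![1, X.u * X.b ^ 2, X.u * X.b ^ 3] ![X.v * X.c ^ 3, X.c] where
  mulVec_eq_zero := by
    ext i
    fin_cases i <;> simp [mulVec, dotProduct, Fin.sum_univ_succ, ← add_assoc,
      X.first_row_relation, X.second_row_relation]
  mem_of_lt i j hij := by
    rw [Ideal.mem_span_singleton]
    fin_cases i <;> fin_cases j <;> first | exact absurd hij (by decide) | simp
  succ_eq_mul i := by fin_cases i <;> simp; ring
  sub_mul_mem i := by
    refine Ideal.mem_sup_left (Ideal.Quotient.eq_zero_iff_mem.1 ?_)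
    fin_cases i <;> simp [f, g, h, X.mk_a]
  last_sub_mem := Ideal.Quotient.eq_zero_iff_mem.1 (by simp [h, X.mk_a])
  isSMulRegular_last := (hX.isSMulRegular_monomials 1 3 0 0 (by simp) rfl).1
  isSMulRegular_cofactor i :=
    (hX.isSMulRegular_monomials (![1, 0] i) (![2, 1] i) (![1, 0] i) (![3, 1] i)
      (by fin_cases i <;> simp) (by fin_cases i <;> simp)).2

theorem relations_mulVec_cubics : X.relations *ᵥ X.cubics = 0 := by
  ext i
  have h₁ := X.first_row_relation
  have h₂ := X.a_sq_mul_d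
  have h₃ := X.b_sq_mul_d
  have h₄ := X.c_sq_mul_d
  have h₅ := X.a_mul_b_mul_c_mul_d
  fin_cases i <;> simp [relations, cubics, mulVec, dotProduct, Fin.sum_univ_succ] <;> grind

theorem isTriangularPresentation_cubics (hX : X.IsRegular) :
    IsTriangularPresentation (Ideal.span {X.a}) X.cubics X.relations
      ![1, X.u, X.u * X.b ^ 2, X.u * X.b ^ 3, X.u ^ 2 * X.b ^ 4, X.u ^ 2 * X.b ^ 5,
        X.u ^ 2 * X.b ^ 6, X.u ^ 3 * X.b ^ 6, X.u ^ 3 * X.b ^ 7, X.u ^ 3 * X.b ^ 8,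
        X.u ^ 3 * X.b ^ 9]
      ![X.v ^ 3 * X.c ^ 9, X.v ^ 3 * X.c ^ 7, X.v ^ 2 * X.c ^ 7, X.v ^ 2 * X.c ^ 6, X.v * X.c ^ 5,
        X.v * X.c ^ 4, X.v * X.c ^ 3, X.c ^ 3, X.c ^ 2, X.c] where
  mulVec_eq_zero := X.relations_mulVec_cubics
  mem_of_lt := X.relations_mem_of_lt
  succ_eq_mul i := by
    fin_cases i <;> simp [relations] <;> ring
  sub_mul_mem i := by
    refine mem_sup_span_singleton_iff.2 ⟨![0, X.u ^ 2 * X.b ^ 5, 0, 0, 0, 0, 0, 0, 0, 0] i, ?_⟩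
    refine Ideal.Quotient.eq_zero_iff_mem.1 ?_
    fin_cases i <;> simp [cubics, f, g, h, d, X.mk_a] <;> ring
  last_sub_mem := Ideal.Quotient.eq_zero_iff_mem.1 (by simp [cubics, h, X.mk_a]; ring)
  isSMulRegular_last := (hX.isSMulRegular_monomials 3 9 0 0 (by simp) rfl).1
  isSMulRegular_cofactor i :=
    (hX.isSMulRegular_monomials (![1, 0, 0, 1, 0, 0, 1, 0, 0, 0] i)
      (![0, 2, 1, 1, 1, 1, 0, 1, 1, 1] i) (![3, 3, 2, 2, 1, 1, 1, 0, 0, 0] i)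
      (![9, 7, 7, 6, 5, 4, 3, 3, 2, 1] i) (by fin_cases i <;> simp [relations])
      (by fin_cases i <;> simp)).2

theorem isSMulRegular_quotient_ideal (hX : X.IsRegular) : IsSMulRegular (R ⧸ X.ideal) X.a := by
  have range_minors : Set.range ![X.f, X.g, X.h] = {X.f, X.g, X.h} := by
    simp only [range_cons, range_empty, Set.union_empty, Set.singleton_union]
  have := X.isTriangularPresentation_minors hX |>.isSMulRegular_quotient_span_range hX.regular_a
  rwa [range_minors] at this

theorem isSMulRegular_quotient_sup_span_d (hX : X.IsRegular) :
    IsSMulRegular (R ⧸ X.ideal ^ 3 ⊔ Ideal.span {X.d}) X.a := by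
  rw [← span_range_cubics]
  exact (X.isTriangularPresentation_cubics hX).isSMulRegular_quotient_span_range hX.regular_a

theorem colon_d (hX : X.IsRegular) : (X.ideal ^ 3).colon {X.d} = X.conductor := by
  rw [ideal_pow_three, ← span_range_relations_column]
  exact (X.isTriangularPresentation_cubics hX).colon_eq_span hX.regular_a 1 (m := 2)
    (Ideal.subset_span ⟨6, rfl⟩)

theorem mul_mem_ideal_pow_three (hX : X.IsRegular) {s t : R} (hs : s ∈ X.conductor)
    (ht : t ∈ X.ideal ^ 3 ⊔ Ideal.span {X.d}) : s * t ∈ X.ideal ^ 3 := by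
  rw [← X.colon_d hX, Submodule.mem_colon_singleton] at hs
  obtain ⟨r, hr⟩ := mem_sup_span_singleton_iff.1 ht
  convert! add_mem (Ideal.mul_mem_left _ s hr) (Ideal.mul_mem_left _ r hs) using 1
  rw [smul_eq_mul]
  ring

theorem colon_span_pow_three (hX : X.IsRegular) :
    (X.ideal ^ 3).colon ((Ideal.span {X.a, X.b, X.c} ^ 3 : Ideal R) : Set R) =
      X.ideal ^ 3 ⊔ Ideal.span {X.d} := by
  apply le_antisymm <;> intro t ht
  · have a_pow_mul_mem : X.a ^ 3 * t ∈ X.ideal ^ 3 := by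
      rw [mul_comm]
      exact Submodule.mem_colon.1 ht _ (Ideal.pow_mem_pow (Ideal.subset_span (by simp)) 3)
    exact mem_of_mul_mem ((X.isSMulRegular_quotient_sup_span_d hX).pow 3)
      (Ideal.mem_sup_left a_pow_mul_mem)
  · refine Submodule.mem_colon.2 fun s hs => ?_
    rw [smul_eq_mul, mul_comm]
    exact X.mul_mem_ideal_pow_three hX (X.span_pow_three_le_conductor hs) ht

theorem sup_span_d_le_ideal (hX : X.IsRegular) : X.ideal ^ 3 ⊔ Ideal.span {X.d} ≤ X.ideal :=
  fun _ ht => mem_of_mul_mem ((X.isSMulRegular_quotient_ideal hX).pow 2) <|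
    Ideal.pow_le_self three_ne_zero <|
      X.mul_mem_ideal_pow_three hX (Ideal.subset_span (by simp)) ht

theorem quotientLength_sup_span_d (hX : X.IsRegular) :
    quotientLength (X.ideal ^ 3 ⊔ Ideal.span {X.d}) (X.ideal ^ 3) =
      Module.length R (R ⧸ X.conductor) := by
  rw [quotientLength_sup_span, X.colon_d hX]

theorem symbolicPower_ideal [IsLocalRing R] [IsNoetherianRing R] (hX : X.IsRegular)
    (ha : X.a ∈ maximalIdeal R)
    (hrad : maximalIdeal R ≤ (X.ideal ⊔ Ideal.span {X.a}).radical) :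
    symbolicPower X.ideal 3 = X.ideal ^ 3 ⊔ Ideal.span {X.d} :=
  symbolicPower_eq ha hrad (X.isSMulRegular_quotient_ideal hX)
    (X.isSMulRegular_quotient_sup_span_d hX) le_sup_left fun _ ht =>
      ⟨2, X.mul_mem_ideal_pow_three hX (Ideal.subset_span (by simp)) ht⟩

end CharTwo

section Powers

/-- The matrix with rows `(x, y ^ β, z ^ γ)` and `(y ^ (2 * β + m), z ^ (2 * γ + n), x ^ 2)`. -/
def ofPowers (x y z : R) (β γ m n : ℕ) : CyclicMatrix R :=
  ⟨x, y ^ β, z ^ γ, y ^ m, z ^ n⟩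

variable {x y z : R} {β γ m n : ℕ}

theorem maximalMinorsIdeal_ofPowers [CharP R 2] :
    maximalMinorsIdeal !![x ^ 1, y ^ β, z ^ γ; y ^ (2 * β + m), z ^ (2 * γ + n), x ^ 2] =
      (ofPowers x y z β γ m n).ideal := by
  rw [← maximalMinorsIdeal_eq_ideal, pow_one, pow_add, pow_add, mul_comm 2, mul_comm 2, pow_mul,
    pow_mul, mul_comm _ (y ^ m), mul_comm _ (z ^ n)]
  rfl

theorem ideal_ofPowers_le (hβ : 0 < β) (hγ : 0 < γ) :
    (ofPowers x y z β γ m n).ideal ≤ Ideal.span {x, y, z} := by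
  refine (ofPowers x y z β γ m n).ideal_le.trans (Ideal.span_le.2 ?_)
  rintro _ (rfl | rfl | rfl)
  exacts [Ideal.subset_span (by simp),
    Ideal.pow_mem_of_mem _ (Ideal.subset_span (by simp)) β hβ,
    Ideal.pow_mem_of_mem _ (Ideal.subset_span (by simp)) γ hγ]

theorem radical_le_radical_ideal_ofPowers_sup_span :
    (Ideal.span {x, y, z}).radical ≤
      ((ofPowers x y z β γ m n).ideal ⊔ Ideal.span {x}).radical := by
  rw [Ideal.radical_le_radical_iff, Ideal.span_le]
  have mem {t : R} {k : ℕ} (h : t ^ k ∈ ({x, y ^ m * (y ^ β) ^ 3, z ^ n * (z ^ γ) ^ 3} : Set R)) :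
      t ∈ ((ofPowers x y z β γ m n).ideal ⊔ Ideal.span {x}).radical :=
    ⟨k, (ofPowers x y z β γ m n).span_le_ideal_sup_span_a (Ideal.subset_span h)⟩
  rintro _ (rfl | rfl | rfl)
  · exact mem (k := 1) (by simp)
  · exact mem (k := m + β * 3) (by simp [pow_add, pow_mul])
  · exact mem (k := n + γ * 3) (by simp [pow_add, pow_mul])

variable [IsLocalRing R]

theorem ideal_ofPowers_ne_top (h : (Ideal.span {x, y, z}).radical = maximalIdeal R) (hβ : 0 < β)
    (hγ : 0 < γ) : (ofPowers x y z β γ m n).ideal ≠ ⊤ :=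
  ne_top_of_le_ne_top (maximalIdeal.isMaximal R).ne_top
    ((ideal_ofPowers_le hβ hγ).trans (h ▸ Ideal.le_radical))

variable [IsNoetherianRing R]

theorem isRegular_ofPowers (hdepth : 3 ≤ moduleDepth R R)
    (h : (Ideal.span {x, y, z}).radical = maximalIdeal R) :
    (ofPowers x y z β γ m n).IsRegular := by
  obtain ⟨regular_x, regular_y, -⟩ := isWeaklyRegular_triple_iff.1
    (isWeaklyRegular_pow hdepth h one_pos one_pos one_pos)
  rw [pow_one] at regular_x
  rw [pow_one, pow_one] at regular_y
  have regular_z (j k : ℕ) : IsSMulRegular (R ⧸ Ideal.span {x} ⊔ Ideal.span {y ^ j}) (z ^ k) := by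
    have := isSMulRegular_quotient_span_pow_sup_span_pow hdepth h 1 j k
    rwa [pow_one] at this
  refine ⟨regular_x, ?_, ?_⟩
  · rintro _ (rfl | rfl)
    exacts [regular_y.pow β, regular_y.pow m]
  · rintro _ (rfl | rfl) _ (rfl | rfl) <;> exact regular_z _ _

theorem length_quotient_conductor_ofPowers (hdepth : 3 ≤ moduleDepth R R)
    (h : (Ideal.span {x, y, z}).radical = maximalIdeal R) :
    Module.length R (R ⧸ (ofPowers x y z β γ m n).conductor) =
      7 * Module.length R (R ⧸ Ideal.span {x, y ^ β, z ^ γ}) := by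
  have hyzx : (Ideal.span {y, z, x}).radical = maximalIdeal R := by
    rw [← h, Set.insert_comm x, Set.pair_comm x]
  have hxzy : (Ideal.span {x, z, y}).radical = maximalIdeal R := by
    rw [← h, Set.pair_comm]
  refine length_quotient_sq_sq_sq_mul ?_ ?_ ?_
  · have := isSMulRegular_quotient_span_pow_sup_span_pow hdepth hyzx (β * 2) (γ * 2) 1
    rwa [pow_one, pow_mul, pow_mul] at this
  · have := isSMulRegular_quotient_span_pow_sup_span_pow hdepth hxzy 1 (γ * 2) β
    rwa [pow_one, pow_mul] at this
  · have := isSMulRegular_quotient_span_pow_sup_span_pow hdepth h 1 β γ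
    rwa [pow_one] at this

end Powers

end CyclicMatrix

theorem theorem4p13 {R : Type*} [CommRing R] [IsCohenMacaulayLocalRing R] [CharP R 2]
    (hdim : ringKrullDim R = 3)
    (x y z : R) (hxyz : IsSystemOfParameters ![x, y, z])
    (α β γ α' β' γ' : ℕ) (hβ : 0 < β) (hγ : 0 < γ)
    (hα : α = 1) (hα' : α' = 2) (hββ' : 2 * β ≤ β') (hγγ' : 2 * γ ≤ γ')
    (I Q : Ideal R)
    (hI : I = maximalMinorsIdeal !![x ^ α, y ^ β, z ^ γ; y ^ β', z ^ γ', x ^ α'])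
    (hQ : Q = Ideal.span {x ^ min α α', y ^ min β β', z ^ min γ γ'}) :
    0 < moduleDepth R (R ⧸ (I ^ 3).colon ((Q ^ 3 : Ideal R) : Set R)) ∧
    symbolicPower I 3 = (I ^ 3).colon ((Q ^ 3 : Ideal R) : Set R) ∧
    quotientLength (symbolicPower I 3) (I ^ 3) = 7 * Module.length R (R ⧸ Q) ∧
    7 * Module.length R (R ⧸ Q) =
      7 * (β : ℕ∞) * (γ : ℕ∞) * Module.length R (R ⧸ Ideal.span {x, y, z}) := by
  subst hα hα'
  obtain ⟨m, rfl⟩ := Nat.exists_eq_add_of_le hββ'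
  obtain ⟨n, rfl⟩ := Nat.exists_eq_add_of_le hγγ'
  let X := CyclicMatrix.ofPowers x y z β γ m n
  obtain rfl : I = X.ideal := hI.trans CyclicMatrix.maximalMinorsIdeal_ofPowers
  obtain rfl : Q = Ideal.span {x, y ^ β, z ^ γ} := by
    rw [hQ, min_eq_left one_le_two, min_eq_left (by omega), min_eq_left (by omega), pow_one]
  have hdepth : 3 ≤ moduleDepth R R :=
    WithBot.coe_le_coe.1 (IsCohenMacaulayLocalRing.depth_eq_dim.trans hdim).ge
  have hrad := hxyz.radical_span_eq
  have hx : x ∈ IsLocalRing.maximalIdeal R :=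
    hrad ▸ Ideal.le_radical (Ideal.subset_span (by simp))
  have hX : X.IsRegular := CyclicMatrix.isRegular_ofPowers hdepth hrad
  have symbolicPower_eq : symbolicPower X.ideal 3 = X.ideal ^ 3 ⊔ Ideal.span {X.d} :=
    X.symbolicPower_ideal hX hx
      (hrad.ge.trans CyclicMatrix.radical_le_radical_ideal_ofPowers_sup_span)
  have colon_eq := X.colon_span_pow_three hX
  refine ⟨?_, symbolicPower_eq.trans colon_eq.symm, ?_, ?_⟩
  · exact colon_eq ▸ moduleDepth_quotient_pos (ne_top_of_le_ne_top
      (CyclicMatrix.ideal_ofPowers_ne_top hrad hβ hγ) (X.sup_span_d_le_ideal hX)) hx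
      (X.isSMulRegular_quotient_sup_span_d hX)
  · rw [symbolicPower_eq, X.quotientLength_sup_span_d hX]
    exact CyclicMatrix.length_quotient_conductor_ofPowers hdepth hrad
  · have := length_quotient_span_pow_pow_pow hdepth hrad 1 β γ
    rw [pow_one, Nat.cast_one, one_mul] at this
    rw [this, mul_assoc, mul_assoc, mul_assoc]
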